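/- Let $n\ge 1$ and let $F$ be an infinite field whose characteristic is $0$ or a prime $p\ge n$. Let $L=UT_n(F)^{(-)}$ be the Lie algebra of upper triangular $n\times n$ matrices over $F$ with bracket $[a,b]=ab-ba$, equipped with the canonical $\mathbb{Z}_n$-grading $L=\bigoplus_{k=0}^{n-1}L_k$, where $L_k$ is the span of the matrix units $e_{ij}$ with $j-i=k$. Let $\mathcal{L}\langle X\rangle$ be the free Lie algebra over $F$ on the variables $x_i^{(g)}$ ($g\in\mathbb{Z}_n$, $i$ in a countably infinite index set), with the $\mathbb{Z}_n$-grading in which $x_i^{(g)}$ has degree $g$. Let $I\subseteq\mathcal{L}\langle X\rangle$ be the ideal of graded identities of $L$, that is, of all $f$ that vanish under every substitution of elements of $L_g$ for the variables $x_i^{(g)}$. A $T_{\mathbb{Z}_n}$-ideal is a $\mathbb{Z}_n$-graded ideal of $\mathcal{L}\langle X\rangle$ that is closed under all endomorphisms of $\mathcal{L}\langle X\rangle$ respecting the grading. Then every $T_{\mathbb{Z}_n}$-ideal $J$ of $\mathcal{L}\langle X\rangle$ with $I\subseteq J$ is finitely generated as a $T_{\mathbb{Z}_n}$-ideal: there is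 a finite set $S\subseteq\mathcal{L}\langle X\rangle$ such that $J$ is the least $T_{\mathbb{Z}_n}$-ideal containing $S$. In other words, the ideal of graded identities of $UT_n(F)^{(-)}$ with the canonical $\mathbb{Z}_n$-grading has the Specht property. -/

import Mathlib

attribute [local instance 100] LieRing.ofAssociativeRing

namespace GradedSpecht

section Free

variable (F : Type*) [Field F] (G : Type*) [AddCommGroup G]

/-- The free Lie algebra on the variables `x_i^{(g)}`, `g ∈ G`, `i ∈ ℕ`;
the variable `x_i^{(g)}` is indexed by the pair `(g, i)`. -/
abbrev FreeGradedLie : Type _ := FreeLieAlgebra F (G × ℕ)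

variable {F G}

/-- `IsMonomialOfDegree g m` : `m` is a Lie monomial (an iterated bracket of variables) and the sum
of the degrees of its variables is `g`. -/
inductive IsMonomialOfDegree : G → FreeGradedLie F G → Prop
  | of (g : G) (i : ℕ) : IsMonomialOfDegree g (FreeLieAlgebra.of F (g, i))
  | lie {g h : G} {a b : FreeGradedLie F G} :
      IsMonomialOfDegree g a → IsMonomialOfDegree h b → IsMonomialOfDegree (g + h) ⁅a, b⁆

variable (F) in
/-- The homogeneous component of degree `g` of the free `G`-graded Lie algebra. -/
noncomputable def freeComponent (g : G) : Submodule F (FreeGradedLie F G) :=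
  Submodule.span F {m | IsMonomialOfDegree g m}

/-- An endomorphism of the free Lie algebra that respects the grading. -/
def IsGradedEndomorphism (φ : FreeGradedLie F G →ₗ⁅F⁆ FreeGradedLie F G) : Prop :=
  ∀ g : G, ∀ a ∈ freeComponent F g, φ a ∈ freeComponent F g

/-- A `T_G`-ideal: a `G`-graded ideal (it is the sum of its intersections with the homogeneous
components) that is closed under the graded endomorphisms. -/
structure IsTIdeal (J : LieIdeal F (FreeGradedLie F G)) : Prop where
  graded : J.toSubmodule = ⨆ g : G, freeComponent F g ⊓ J.toSubmodule
  map_mem : ∀ φ : FreeGradedLie F G →ₗ⁅F⁆ FreeGradedLie F G, IsGradedEndomorphism φ →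
    ∀ f ∈ J, φ f ∈ J

/-- `J` is finitely generated as a `T_G`-ideal: it is the least `T_G`-ideal containing some finite
set of graded polynomials. -/
def IsFinitelyGeneratedTIdeal (J : LieIdeal F (FreeGradedLie F G)) : Prop :=
  ∃ S : Set (FreeGradedLie F G), S.Finite ∧
    IsLeast {K : LieIdeal F (FreeGradedLie F G) | IsTIdeal K ∧ S ⊆ K} J

variable {L : Type*} [LieRing L] [LieAlgebra F L]

/-- The ideal `T_G(L)` of graded identities of the Lie algebra `L` with homogeneous components
`𝒜 g`: the `f` that vanish whenever each variable `x_i^{(g)}` is replaced by an element of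
`𝒜 g`. -/
noncomputable def gradedIdentities (𝒜 : G → Submodule F L) : LieIdeal F (FreeGradedLie F G) where
  carrier := {f | ∀ a : G × ℕ → L, (∀ x, a x ∈ 𝒜 x.1) → FreeLieAlgebra.lift F a f = 0}
  zero_mem' := fun a _ => map_zero _
  add_mem' := fun hf hg a ha => by rw [map_add, hf a ha, hg a ha, add_zero]
  smul_mem' := fun c f hf a ha => by rw [map_smul, hf a ha, smul_zero]
  lie_mem := fun {x f} hf a ha => by rw [LieHom.map_lie, hf a ha, lie_zero]

/-- The Specht property of `T_G(L)`. -/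
def HasSpechtProperty (𝒜 : G → Submodule F L) : Prop :=
  ∀ J : LieIdeal F (FreeGradedLie F G), IsTIdeal J → gradedIdentities 𝒜 ≤ J →
    IsFinitelyGeneratedTIdeal J

end Free

section UT

variable (n : ℕ) (F : Type*) [Field F]

/-- `UT_n(F)^{(-)}`: the upper triangular `n × n` matrices, as a Lie algebra under the
commutator. -/
def upperTriangularLie : LieSubalgebra F (Matrix (Fin n) (Fin n) F) where
  carrier := {A | A.IsUpperTriangular}
  zero_mem' := Matrix.blockTriangular_zero
  add_mem' := fun hA hB => hA.add hB
  smul_mem' := fun c A hA i j hij => by simp [hA hij]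
  lie_mem' := fun hA hB => (hA.mul hB).sub (hB.mul hA)

variable {n}

/-- The canonical `ℤ_n`-grading on `UT_n(F)^{(-)}`: for `k = 0, …, n - 1`, the component of degree
`k` is spanned by the matrix units `e_{ij}` with `j - i = k`. -/
noncomputable def canonicalGrading [NeZero n] (k : ZMod n) : Submodule F (upperTriangularLie n F) :=
  Submodule.span F {A | ∃ i j : Fin n, (j : ℕ) = (i : ℕ) + k.val ∧
    (A : Matrix (Fin n) (Fin n) F) = Matrix.single i j 1}

end UT

end GradedSpecht

/-! Two families of identities of `L` carry the whole argument: variables of degree `0` commute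
(they take diagonal values), and right-normed brackets of `n` variables of nonzero degree vanish
(strictly upper triangular values). In the quotient `Q` of the free algebra by their consequences,
the adjoint maps of the degree `0` generators commute, so polynomials in them act on `Q`. Hence `Q`
is spanned by the degree `0` generators and by words of fewer than `n` letters, each letter a
generator of nonzero degree acted on by a monomial (`RelativelyFree.mem_sup`).

It suffices to generate finitely the subspaces of `Q` stable under degree-preserving substitutions.
Rescaling variables over an infinite field separates the word lengths (`mem_of_length_components`).
Polarization reduces length `k` to multilinear words (`mem_of_multilinear`) at the cost of dividing
by `k!`, which is invertible as `k < n` and the characteristic is `0` or at least `n`.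

A multilinear word is recorded by a permutation and a tuple of exponents. Substitutions realise
multiplication by monomials and increasing shifts of the indices, so a Cohen-type theorem
(`exists_finite_basis_shiftAdd`) applies. It is proved by leading-term reduction, with Higman's
lemma in place of Dickson's. Finitely many lengths and degree tuples occur, so finitely many
generators suffice. -/

namespace GradedSpecht

/-! ### Leading-term reduction over a well-quasi-order -/

section FiniteBasis

variable {F : Type*} [Field F] {ι Ω : Type*} [LinearOrder Ω]

/-- The index `a` is the leading index of `p` with respect to the order pulled back along `key`. -/
def IsLeading (key : ι → Ω) (p : ι →₀ F) (a : ι) : Prop :=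
  a ∈ p.support ∧ ∀ b ∈ p.support, key b ≤ key a

lemma exists_isLeading (key : ι → Ω) {p : ι →₀ F} (hp : p ≠ 0) : ∃ a, IsLeading key p a := by
  obtain ⟨a, ha, h⟩ := p.support.exists_max_image key (Finsupp.support_nonempty_iff.2 hp)
  exact ⟨a, ha, h⟩

/-- A subspace of `ι →₀ F` that is closed under a family `T` of index substitutions is generated
by finitely many elements, if `T` is strictly monotone for a well-order and the divisibility
relation of `T` is a well-quasi-order. -/
theorem exists_finite_basis [WellFoundedLT Ω] (key : ι → Ω) (hkey : Function.Injective key)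
    (T : Set (ι → ι)) (hT : ∀ τ ∈ T, ∀ a b, key a < key b → key (τ a) < key (τ b))
    (hwqo : ∀ f : ℕ → ι, ∃ i j, i < j ∧ ∃ τ ∈ T, τ (f i) = f j)
    (N : Submodule F (ι →₀ F)) (hN : ∀ τ ∈ T, ∀ p ∈ N, p.mapDomain τ ∈ N) :
    ∃ S : Set (ι →₀ F), S.Finite ∧ S ⊆ N ∧ ∀ N' : Submodule F (ι →₀ F),
      (∀ τ ∈ T, ∀ p ∈ N', p.mapDomain τ ∈ N') → S ⊆ N' → N ≤ N' := by
  classical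
  -- Otherwise one can choose an infinite sequence of leading indices, none obtained from an earlier
  -- one by a substitution in `T`, against `hwqo`.
  have key_lemma : ∃ A : Finset ι, (∀ a ∈ A, ∃ p ∈ N, IsLeading key p a) ∧
      ∀ b, (∃ p ∈ N, IsLeading key p b) → ∃ a ∈ A, ∃ τ ∈ T, τ a = b := by
    by_contra! hcon
    obtain ⟨f, -, h2⟩ := exists_seq_of_forall_finset_exists
      (fun b => ∃ p ∈ N, IsLeading key p b) (fun a b => ∀ τ ∈ T, τ a ≠ b)
      (fun A hA => hcon A hA)
    obtain ⟨i, j, hij, τ, hτ, h⟩ := hwqo f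
    exact h2 i j hij τ hτ h
  obtain ⟨A, hA, hA'⟩ := key_lemma
  choose! q hqN hq using hA
  refine ⟨q '' A, A.finite_toSet.image q, ?_, fun N' hN' hS => ?_⟩
  · rintro _ ⟨a, ha, rfl⟩
    exact hqN a ha
  have main : ∀ w : Ω, ∀ p ∈ N, ∀ a, IsLeading key p a → key a = w → p ∈ N' := by
    intro w
    induction w using WellFoundedLT.induction with
    | ind w ih =>
      rintro p hp b hb rfl
      obtain ⟨a, ha, τ, hτ, rfl⟩ := hA' b ⟨p, hp, hb⟩
      have hinj : Function.Injective τ := by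
        intro x y hxy
        by_contra hne
        rcases lt_or_gt_of_ne (fun h => hne (hkey h)) with h | h
        · exact (hT τ hτ _ _ h).ne (by rw [hxy])
        · exact (hT τ hτ _ _ h).ne (by rw [hxy])
      have hmono : ∀ x y, key x ≤ key y → key (τ x) ≤ key (τ y) := by
        intro x y hxy
        rcases hxy.lt_or_eq with h | h
        · exact (hT τ hτ _ _ h).le
        · rw [hkey h]
      -- Strict monotonicity keeps `τ a` the leading index of the substituted `q a`. This `c`
      -- cancels it against that of `p`, so the remainder has a smaller leading key.
      set c : F := p (τ a) / q a a with hc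
      have hqa : q a a ≠ 0 := Finsupp.mem_support_iff.1 (hq a ha).1
      set r : ι →₀ F := p - c • (q a).mapDomain τ with hr
      have hrN : r ∈ N := N.sub_mem hp (N.smul_mem _ (hN τ hτ _ (hqN a ha)))
      have hrN' : r ∈ N' := by
        by_cases hr0 : r = 0
        · rw [hr0]; exact N'.zero_mem
        obtain ⟨d, hd⟩ := exists_isLeading key hr0
        refine ih (key d) ?_ r hrN d hd rfl
        have hle : key d ≤ key (τ a) := by
          have hd1 := hd.1
          by_cases hdp : d ∈ p.support
          · exact hb.2 d hdp
          · have : d ∈ ((q a).mapDomain τ).support := by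
              rw [Finsupp.mem_support_iff] at hd1 ⊢
              intro h0
              apply hd1
              rw [Finsupp.notMem_support_iff] at hdp
              simp [hr, h0, hdp]
            obtain ⟨e, he, rfl⟩ := Finset.mem_image.1 (Finsupp.mapDomain_support this)
            exact hmono _ _ ((hq a ha).2 e he)
        refine lt_of_le_of_ne hle fun h => ?_
        have : d = τ a := hkey h
        apply Finsupp.mem_support_iff.1 hd.1
        rw [this, hr]
        simp [Finsupp.mapDomain_apply hinj, hc, hqa]
      have : p = r + c • (q a).mapDomain τ := by simp [hr]
      rw [this]
      exact N'.add_mem hrN' (N'.smul_mem _ (hN' τ hτ _ (hS ⟨a, ha, rfl⟩)))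
  intro p hp
  by_cases hp0 : p = 0
  · rw [hp0]; exact N'.zero_mem
  obtain ⟨a, ha⟩ := exists_isLeading key hp0
  exact main _ p hp a ha rfl

end FiniteBasis

/-! ### Cohen's theorem for exponents, via Higman's lemma -/

section Exponents

variable {C : Type*} {M : ℕ}

/-- The substitution on exponents: shift the indices of the variables by `t` and multiply by the
monomial with exponent `u`. -/
noncomputable def shiftAdd (t : ℕ → ℕ) (u : Fin M → ℕ →₀ ℕ) (a : C × (Fin M → ℕ →₀ ℕ)) :
    C × (Fin M → ℕ →₀ ℕ) :=
  (a.1, fun i => (a.2 i).mapDomain t + u i)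

/-- The exponent `s`, seen in the lexicographic order in which large indices dominate. -/
def lexExponent (s : ℕ →₀ ℕ) : Lex (ℕᵒᵈ →₀ ℕ) := toLex s

/-- The highest differing index decides, so the variables increase with their index. In the opposite
convention they would form an infinite descending chain. -/
lemma lexExponent_lt_iff {a b : ℕ →₀ ℕ} :
    lexExponent a < lexExponent b ↔ ∃ i, (∀ j, i < j → a j = b j) ∧ a i < b i :=
  Finsupp.Lex.lt_iff

/-- The deciding index `i` moves to `t i`. Indices outside the range of `t` receive only `u`, the
same on both sides. -/
lemma lexExponent_shift_lt {t : ℕ → ℕ} (ht : StrictMono t) (u : ℕ →₀ ℕ) {a b : ℕ →₀ ℕ}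
    (h : lexExponent a < lexExponent b) :
    lexExponent (a.mapDomain t + u) < lexExponent (b.mapDomain t + u) := by
  rw [lexExponent_lt_iff] at h ⊢
  obtain ⟨i, h1, h2⟩ := h
  refine ⟨t i, fun j hj => ?_, ?_⟩
  · rw [Finsupp.add_apply, Finsupp.add_apply]
    congr 1
    by_cases hjr : j ∈ Set.range t
    · obtain ⟨k, rfl⟩ := hjr
      rw [Finsupp.mapDomain_apply ht.injective, Finsupp.mapDomain_apply ht.injective]
      exact h1 k (ht.lt_iff_lt.1 hj)
    · rw [Finsupp.mapDomain_of_notMem_range _ _ hjr, Finsupp.mapDomain_of_notMem_range _ _ hjr]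
  · rw [Finsupp.add_apply, Finsupp.add_apply, Finsupp.mapDomain_apply ht.injective,
      Finsupp.mapDomain_apply ht.injective]
    omega

/-- A well-ordered key for the indices `C × (Fin M → ℕ →₀ ℕ)`. -/
noncomputable def exponentKey (k : ℕ) (e : C ≃ Fin k) (a : C × (Fin M → ℕ →₀ ℕ)) :
    Fin k ×ₗ Lex (Fin M → Lex (ℕᵒᵈ →₀ ℕ)) :=
  toLex (e a.1, toLex fun i => lexExponent (a.2 i))

lemma exponentKey_injective (k : ℕ) (e : C ≃ Fin k) :
    Function.Injective (exponentKey (M := M) k e) := by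
  rintro ⟨a, s⟩ ⟨b, r⟩ h
  have h' := Prod.ext_iff.1 (toLex.injective h)
  refine Prod.ext (e.injective h'.1) (funext fun i => ?_)
  exact toLex.injective (congrFun (toLex.injective h'.2) i)

lemma exponentKey_shiftAdd_lt (k : ℕ) (e : C ≃ Fin k) {t : ℕ → ℕ} (ht : StrictMono t)
    (u : Fin M → ℕ →₀ ℕ) (a b : C × (Fin M → ℕ →₀ ℕ))
    (h : exponentKey k e a < exponentKey k e b) :
    exponentKey k e (shiftAdd t u a) < exponentKey k e (shiftAdd t u b) := by
  rw [exponentKey, exponentKey, Prod.Lex.toLex_lt_toLex] at h ⊢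
  refine h.imp id fun ⟨h1, h2⟩ => ⟨h1, ?_⟩
  obtain ⟨i, h3, h4⟩ := h2
  refine ⟨i, fun j hj => ?_, lexExponent_shift_lt ht (u i) h4⟩
  have h5 : a.2 j = b.2 j := toLex.injective (h3 j hj)
  simp [shiftAdd, h5]

/-- The list of the exponent vectors of the successive variables. -/
noncomputable def exponentList (s : Fin M → ℕ →₀ ℕ) : List (Fin M → ℕ) :=
  (List.range ((Finset.univ.biUnion fun i => (s i).support).sup id + 1)).map fun k i => s i k

lemma exponentList_getElem? (s : Fin M → ℕ →₀ ℕ) (k : ℕ) :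
    (exponentList s)[k]? = some (fun i => s i k) ∨
      ((exponentList s)[k]? = none ∧ ∀ i, s i k = 0) := by
  by_cases h : k < (Finset.univ.biUnion fun i => (s i).support).sup id + 1
  · left
    rw [exponentList, List.getElem?_map, List.getElem?_range h]; rfl
  · right
    refine ⟨by simpa [exponentList] using h, fun i => ?_⟩
    by_contra hne
    apply h
    have : k ∈ Finset.univ.biUnion fun i => (s i).support :=
      Finset.mem_biUnion.2 ⟨i, Finset.mem_univ i, Finsupp.mem_support_iff.2 hne⟩
    exact Nat.lt_succ_of_le (Finset.le_sup (f := id) this)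

/-- Positions in the lists are indices of variables, so the order embedding behind the sublist
relation is the required shift. Past the end of the list of `s` all exponents are zero. -/
lemma exists_strictMono_le (s r : Fin M → ℕ →₀ ℕ)
    (h : List.SublistForall₂ (· ≤ ·) (exponentList s) (exponentList r)) :
    ∃ t : ℕ → ℕ, StrictMono t ∧ ∀ i, (s i).mapDomain t ≤ r i := by
  obtain ⟨l, hl, hsub⟩ := List.sublistForall₂_iff.1 h
  obtain ⟨t, ht⟩ := List.sublist_iff_exists_orderEmbedding_getElem?_eq.1 hsub
  refine ⟨t, t.strictMono, fun i j => ?_⟩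
  by_cases hjr : j ∈ Set.range t
  · obtain ⟨k, rfl⟩ := hjr
    rw [Finsupp.mapDomain_apply t.injective]
    rcases exponentList_getElem? s k with h1 | h1
    · obtain ⟨hlen, hget⟩ := List.forall₂_iff_get.1 hl
      obtain ⟨hk, h1'⟩ := List.getElem?_eq_some_iff.1 h1
      have h2 := hget k hk (hlen ▸ hk)
      have h3 : (exponentList r)[t k]? = some (l.get ⟨k, hlen ▸ hk⟩) := by
        rw [← ht k]; simp [hlen ▸ hk]
      rcases exponentList_getElem? r (t k) with h4 | h4
      · rw [h3] at h4
        have h5 := Option.some.inj h4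
        rw [h5] at h2
        have h6 := h2 i
        rw [List.get_eq_getElem] at h6
        simp only [h1'] at h6
        exact h6
      · rw [h3] at h4
        exact absurd h4.1 (by simp)
    · rw [h1.2 i]; exact Nat.zero_le _
  · rw [Finsupp.mapDomain_of_notMem_range _ _ hjr]; exact Nat.zero_le _

/-- Dickson's lemma orders the letters `Fin M → ℕ`, Higman's lemma the lists of them, and equality
on a finite `C` is harmless. The monomial `u` is the difference left after the shift. -/
lemma exists_shiftAdd_eq [Finite C] (f : ℕ → C × (Fin M → ℕ →₀ ℕ)) :
    ∃ i j, i < j ∧ ∃ τ ∈ {τ | ∃ t u, StrictMono t ∧ τ = shiftAdd (C := C) (M := M) t u},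
      τ (f i) = f j := by
  have h1 : WellQuasiOrdered (List.SublistForall₂ ((· ≤ ·) : (Fin M → ℕ) → (Fin M → ℕ) → Prop)) := by
    have := Set.PartiallyWellOrderedOn.partiallyWellOrderedOn_sublistForall₂
      ((· ≤ ·) : (Fin M → ℕ) → (Fin M → ℕ) → Prop) (s := Set.univ)
      (Set.partiallyWellOrderedOn_univ_iff.2 wellQuasiOrdered_le)
    simpa [Set.partiallyWellOrderedOn_univ_iff] using this
  have h2 : WellQuasiOrdered ((· = ·) : C → C → Prop) := Finite.wellQuasiOrdered _
  obtain ⟨i, j, hij, h3, h4⟩ := (h2.prod h1) fun k => ((f k).1, exponentList (f k).2)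
  obtain ⟨t, ht, h5⟩ := exists_strictMono_le _ _ h4
  refine ⟨i, j, hij, _, ⟨t, fun l => (f j).2 l - ((f i).2 l).mapDomain t, ht, rfl⟩, ?_⟩
  refine Prod.ext h3 (funext fun l => ?_)
  exact add_tsub_cancel_of_le (h5 l)

/-- Cohen's theorem for free modules of finite rank: a subspace spanned by exponents that is closed
under multiplication by monomials and under strictly increasing shifts of the variables is
generated by a finite set. -/
theorem exists_finite_basis_shiftAdd (F : Type*) [Field F] [Finite C]
    (N : Submodule F (C × (Fin M → ℕ →₀ ℕ) →₀ F))
    (hN : ∀ t u, StrictMono t → ∀ p ∈ N, p.mapDomain (shiftAdd t u) ∈ N) :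
    ∃ S : Set (C × (Fin M → ℕ →₀ ℕ) →₀ F), S.Finite ∧ S ⊆ N ∧
      ∀ N' : Submodule F (C × (Fin M → ℕ →₀ ℕ) →₀ F),
      (∀ t u, StrictMono t → ∀ p ∈ N', p.mapDomain (shiftAdd t u) ∈ N') → S ⊆ N' → N ≤ N' := by
  obtain ⟨k, ⟨e⟩⟩ := Finite.exists_equiv_fin C
  obtain ⟨S, h1, h2, h3⟩ := exists_finite_basis (exponentKey (M := M) k e)
    (exponentKey_injective k e) {τ | ∃ t u, StrictMono t ∧ τ = shiftAdd t u}
    (by rintro _ ⟨t, u, ht, rfl⟩ a b h; exact exponentKey_shiftAdd_lt k e ht u a b h)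
    exists_shiftAdd_eq N (by rintro _ ⟨t, u, ht, rfl⟩; exact hN t u ht)
  refine ⟨S, h1, h2, fun N' hN' => h3 N' ?_⟩
  rintro _ ⟨t, u, ht, rfl⟩
  exact hN' t u ht

end Exponents

end GradedSpecht

namespace GradedSpecht

/-! ### Right-normed words and polynomial actions -/

section Words

variable (F : Type*) [Field F] {Q : Type*} [LieRing Q] [LieAlgebra F Q]

/-- The right-normed bracket `⁅v 0, ⁅v 1, … v m⁆⁆` of `m + 1` elements. -/
def word : ∀ m : ℕ, (Fin (m + 1) → Q) → Q
  | 0, v => v 0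
  | m + 1, v => ⁅v 0, word m (Fin.tail v)⁆

variable (Q) in
/-- The right-normed bracket as a multilinear map. -/
noncomputable def wordMultilinear : ∀ m : ℕ, MultilinearMap F (fun _ : Fin (m + 1) => Q) Q
  | 0 => MultilinearMap.ofSubsingleton F Q Q (0 : Fin 1) LinearMap.id
  | m + 1 => LinearMap.uncurryLeft
      { toFun := fun x => (LieAlgebra.ad F Q x : Q →ₗ[F] Q).compMultilinearMap (wordMultilinear m)
        map_add' := fun x y => by ext v; simp
        map_smul' := fun c x => by ext v; simp }

lemma wordMultilinear_apply (m : ℕ) (v : Fin (m + 1) → Q) :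
    wordMultilinear F Q m v = word m v := by
  induction m with
  | zero => rfl
  | succ m ih => simp [wordMultilinear, word, LinearMap.uncurryLeft_apply, ih]

lemma word_smul (m : ℕ) (c : Fin (m + 1) → F) (v : Fin (m + 1) → Q) :
    word m (fun i => c i • v i) = (∏ i, c i) • word m v := by
  simpa only [wordMultilinear_apply] using (wordMultilinear F Q m).map_smul_univ c v

lemma word_sum (F : Type*) [Field F] {Q : Type*} [LieRing Q] [LieAlgebra F Q] {α : Type*} [Fintype α] (m : ℕ) (v : Fin (m + 1) → α → Q) :
    word m (fun i => ∑ j, v i j) = ∑ κ : Fin (m + 1) → α, word m (fun i => v i (κ i)) := by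
  simpa only [wordMultilinear_apply] using (wordMultilinear F Q m).map_sum v

variable {F} in
lemma map_word {Q' : Type*} [LieRing Q'] [LieAlgebra F Q'] (φ : Q →ₗ⁅F⁆ Q') (m : ℕ)
    (v : Fin (m + 1) → Q) : φ (word m v) = word m (fun i => φ (v i)) := by
  induction m with
  | zero => rfl
  | succ m ih => rw [word, LieHom.map_lie, ih]; rfl

lemma lie_word (m : ℕ) (d : Q) (v : Fin (m + 1) → Q) :
    ⁅d, word m v⁆ = ∑ j, word m (Function.update v j ⁅d, v j⁆) := by
  induction m with
  | zero => simp [word]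
  | succ m ih =>
    rw [word, leibniz_lie, ih, lie_sum]
    rw [Fin.sum_univ_succ (n := m + 1)]
    refine congrArg₂ _ ?_ (Finset.sum_congr rfl fun j _ => ?_)
    · rw [word, Fin.tail_update_zero, Function.update_self]
    · rw [word, Fin.tail_update_succ, Function.update_of_ne (Fin.succ_ne_zero j).symm]
      rfl

end Words

open scoped IsMulCommutative in
/-- Evaluation of polynomials at pairwise commuting elements of a noncommutative algebra. -/
theorem exists_aeval_of_commute {F A : Type*} [Field F] [Ring A] [Algebra F A] {κ : Type*} (a : κ → A)
    (ha : ∀ i j, a i * a j = a j * a i) :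
    ∃ D : MvPolynomial κ F →ₐ[F] A, ∀ i, D (MvPolynomial.X i) = a i := by
  have := Algebra.isMulCommutative_adjoin F (s := Set.range a) (by
    rintro _ ⟨i, rfl⟩ _ ⟨j, rfl⟩; exact ha i j)
  let D : MvPolynomial κ F →ₐ[F] Algebra.adjoin F (Set.range a) :=
    MvPolynomial.aeval (S₁ := Algebra.adjoin F (Set.range a)) fun i => ⟨a i, Algebra.subset_adjoin ⟨i, rfl⟩⟩
  exact ⟨(Algebra.adjoin F (Set.range a)).val.comp D, fun i => by simp [D]⟩

/-- The action of the polynomial ring on a Lie algebra in which the variables act as the adjoint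
maps of commuting elements. -/
theorem exists_adPoly {F : Type*} [Field F] {Q : Type*} [LieRing Q] [LieAlgebra F Q] (d : ℕ → Q)
    (hd : ∀ i j, ⁅d i, d j⁆ = 0) :
    ∃ D : MvPolynomial ℕ F →ₐ[F] Module.End F Q, ∀ i x, D (MvPolynomial.X i) x = ⁅d i, x⁆ := by
  obtain ⟨D, hD⟩ := exists_aeval_of_commute (F := F) (A := Module.End F Q)
    (fun i => LieAlgebra.ad F Q (d i)) (by
      intro i j
      ext x
      simp only [Module.End.mul_apply, LieAlgebra.ad_apply]
      rw [leibniz_lie, hd, zero_lie, zero_add])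
  exact ⟨D, fun i x => by rw [hD, LieAlgebra.ad_apply]⟩

/-! ### Relatively free algebras and their spanning words -/

variable {F : Type*} [Field F] {G : Type*} [AddCommGroup G]
  {Q : Type*} [LieRing Q] [LieAlgebra F Q] {N : ℕ}

variable (F G Q N) in
/-- A Lie algebra with homogeneous components `comp g` and homogeneous generators `gen (g, i)`,
relatively free for substitutions respecting the degrees, in which the generators of degree `0`
commute and the right-normed brackets of `N + 1` generators of nonzero degree vanish. -/
structure RelativelyFree where
  gen : G × ℕ → Q
  comp : G → Submodule F Q
  gen_mem : ∀ x, gen x ∈ comp x.1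
  lie_mem : ∀ {g h a b}, a ∈ comp g → b ∈ comp h → ⁅a, b⁆ ∈ comp (g + h)
  lie_gen_zero : ∀ i j, ⁅gen (0, i), gen (0, j)⁆ = 0
  word_gen : ∀ z : Fin (N + 1) → G, (∀ i, z i ≠ 0) → word N (fun i => gen (z i, i)) = 0
  exists_hom : ∀ a : G × ℕ → Q, (∀ x, a x ∈ comp x.1) → ∃ φ : Q →ₗ⁅F⁆ Q, ∀ x, φ (gen x) = a x
  eq_top : ∀ U : Submodule F Q, (∀ x, gen x ∈ U) → (∀ x, ∀ u ∈ U, ⁅gen x, u⁆ ∈ U) → U = ⊤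

namespace RelativelyFree

variable (R : RelativelyFree F G Q N)

/-- Stability of a subspace under the endomorphisms that respect the degrees. -/
def Stable (V : Submodule F Q) : Prop :=
  ∀ φ : Q →ₗ⁅F⁆ Q, (∀ x, φ (R.gen x) ∈ R.comp x.1) → ∀ v ∈ V, φ v ∈ V

/-- The action of the polynomials in the generators of degree `0`. -/
noncomputable def act : MvPolynomial ℕ F →ₐ[F] Module.End F Q :=
  (exists_adPoly (F := F) (fun i => R.gen (0, i)) R.lie_gen_zero).choose

lemma act_X (i : ℕ) (x : Q) : R.act (MvPolynomial.X i) x = ⁅R.gen (0, i), x⁆ :=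
  (exists_adPoly (F := F) (fun i => R.gen (0, i)) R.lie_gen_zero).choose_spec i x

lemma act_mem (p : MvPolynomial ℕ F) {g : G} {x : Q} (hx : x ∈ R.comp g) :
    R.act p x ∈ R.comp g := by
  induction p using MvPolynomial.induction_on generalizing x with
  | C a =>
    rw [← MvPolynomial.algebraMap_eq, AlgHom.commutes, Module.algebraMap_end_apply]
    exact (R.comp g).smul_mem a hx
  | add p q hp hq =>
    rw [map_add, LinearMap.add_apply]
    exact (R.comp g).add_mem (hp hx) (hq hx)
  | mul_X p i hp =>
    rw [map_mul, Module.End.mul_apply, act_X]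
    refine hp ?_
    simpa using R.lie_mem (R.gen_mem (0, i)) hx

lemma map_act (φ : Q →ₗ⁅F⁆ Q) (t : ℕ → ℕ) (hφ : ∀ i, φ (R.gen (0, i)) = R.gen (0, t i))
    (p : MvPolynomial ℕ F) (x : Q) : φ (R.act p x) = R.act (MvPolynomial.rename t p) (φ x) := by
  induction p using MvPolynomial.induction_on generalizing x with
  | C a =>
    rw [MvPolynomial.rename_C, ← MvPolynomial.algebraMap_eq, AlgHom.commutes,
      Module.algebraMap_end_apply, Module.algebraMap_end_apply, map_smul]
  | add p q hp hq =>
    rw [map_add, LinearMap.add_apply, map_add, hp, hq, map_add, map_add,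
      LinearMap.add_apply]
  | mul_X p i hp =>
    rw [map_mul, Module.End.mul_apply, act_X, hp, LieHom.map_lie, hφ, ← act_X, map_mul, map_mul,
      Module.End.mul_apply, MvPolynomial.rename_X]

lemma map_act_of_fixed (φ : Q →ₗ⁅F⁆ Q) (hφ : ∀ i, φ (R.gen (0, i)) = R.gen (0, i))
    (p : MvPolynomial ℕ F) (x : Q) : φ (R.act p x) = R.act p (φ x) := by
  rw [R.map_act φ id hφ, MvPolynomial.rename_id_apply]

/-- The action of a monomial. -/
noncomputable def mon (s : ℕ →₀ ℕ) : Module.End F Q := R.act (MvPolynomial.monomial s 1)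

lemma mon_add (s r : ℕ →₀ ℕ) (x : Q) : R.mon (s + r) x = R.mon s (R.mon r x) := by
  rw [mon, mon, mon, ← Module.End.mul_apply, ← map_mul, MvPolynomial.monomial_mul, one_mul]

lemma mon_zero (x : Q) : R.mon 0 x = x := by
  rw [mon, ← MvPolynomial.C_apply, MvPolynomial.C_1, map_one, Module.End.one_apply]

lemma mon_single (i : ℕ) (x : Q) : R.mon (Finsupp.single i 1) x = ⁅R.gen (0, i), x⁆ :=
  R.act_X i x

lemma map_mon (φ : Q →ₗ⁅F⁆ Q) (t : ℕ → ℕ) (hφ : ∀ i, φ (R.gen (0, i)) = R.gen (0, t i))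
    (s : ℕ →₀ ℕ) (x : Q) : φ (R.mon s x) = R.mon (s.mapDomain t) (φ x) := by
  rw [mon, mon, R.map_act φ t hφ, MvPolynomial.rename_monomial]

lemma map_mon_of_fixed (φ : Q →ₗ⁅F⁆ Q) (hφ : ∀ i, φ (R.gen (0, i)) = R.gen (0, i))
    (s : ℕ →₀ ℕ) (x : Q) : φ (R.mon s x) = R.mon s (φ x) :=
  R.map_act_of_fixed φ hφ _ x

/-- The word with letters `z i` acted on by the monomials `s i`. -/
noncomputable def letterWord (m : ℕ) (a : (Fin (m + 1) → G × ℕ) × (Fin (m + 1) → ℕ →₀ ℕ)) : Q :=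
  word m fun i => R.mon (a.2 i) (R.gen (a.1 i))

/-- The span of the generators of degree `0`. -/
def linearPart : Submodule F Q := Submodule.span F (Set.range fun i => R.gen (0, i))

/-- The span of the words of length `m + 1` in the letters of nonzero degree. -/
def wordPart (m : ℕ) : Submodule F Q :=
  Submodule.span F (R.letterWord m '' {a | ∀ i, (a.1 i).1 ≠ 0})

lemma letterWord_mem (m : ℕ) (z : Fin (m + 1) → G × ℕ) (s : Fin (m + 1) → ℕ →₀ ℕ)
    (hz : ∀ i, (z i).1 ≠ 0) : R.letterWord m (z, s) ∈ R.wordPart m :=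
  Submodule.subset_span ⟨(z, s), hz, rfl⟩

/-- Acting by degree `0` generators preserves degrees, so each letter may be substituted for a
generator in `word_gen`; using the position as index keeps those generators distinct. Longer words
end in a vanishing one. -/
lemma letterWord_eq_zero (m : ℕ) (hm : N ≤ m) (z : Fin (m + 1) → G × ℕ)
    (s : Fin (m + 1) → ℕ →₀ ℕ) (hz : ∀ i, (z i).1 ≠ 0) : R.letterWord m (z, s) = 0 := by
  classical
  induction m, hm using Nat.le_induction with
  | base =>
    obtain ⟨φ, hφ⟩ := R.exists_hom
      (fun x => if h : ∃ i : Fin (N + 1), x = ((z i).1, (i : ℕ)) then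
        R.mon (s h.choose) (R.gen (z h.choose)) else R.gen x) (by
        intro x
        split_ifs with h
        · have := congrArg Prod.fst h.choose_spec
          dsimp only at this
          rw [this]
          exact R.act_mem _ (R.gen_mem _)
        · exact R.gen_mem x)
    have h0 := congrArg φ (R.word_gen (fun i => (z i).1) hz)
    rw [map_word, map_zero] at h0
    rw [letterWord, ← h0]
    congr 1
    funext i
    have h : ∃ j : Fin (N + 1), ((z i).1, (i : ℕ)) = ((z j).1, (j : ℕ)) := ⟨i, rfl⟩
    have hi : h.choose = i := Fin.ext (congrArg Prod.snd h.choose_spec).symm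
    rw [hφ, dif_pos h, hi]
  | succ m hm ih =>
    have := ih (Fin.tail z) (Fin.tail s) fun i => hz _
    rw [letterWord, word]
    rw [letterWord] at this
    erw [this]
    rw [lie_zero]

/-- The sum is stable under bracketing with a generator: one of degree `0` acts as a derivation and
raises one exponent at a time, one of nonzero degree prepends a letter, and words longer than `N`
vanish. -/
lemma mem_sup (x : Q) : x ∈ R.linearPart ⊔ ⨆ m : Fin N, R.wordPart m := by
  set U := R.linearPart ⊔ ⨆ m : Fin N, R.wordPart m with hU
  have hword : ∀ m z s, (∀ i, (z i).1 ≠ 0) → R.letterWord m (z, s) ∈ U := by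
    intro m z s hz
    by_cases hm : m < N
    · exact Submodule.mem_sup_right (Submodule.mem_iSup_of_mem ⟨m, hm⟩ (R.letterWord_mem m z s hz))
    · rw [R.letterWord_eq_zero m (not_lt.1 hm) z s hz]
      exact U.zero_mem
  have hlin : ∀ i, R.gen (0, i) ∈ U := fun i =>
    Submodule.mem_sup_left (Submodule.subset_span ⟨i, rfl⟩)
  have hword0 : ∀ x s, x.1 ≠ 0 → R.mon s (R.gen x) ∈ U := fun x s hx =>
    hword 0 (fun _ => x) (fun _ => s) fun _ => hx
  have hgen : ∀ x, R.gen x ∈ U := by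
    intro x
    by_cases hx : x.1 = 0
    · obtain ⟨g, i⟩ := x
      obtain rfl : g = 0 := hx
      exact hlin i
    · rw [← R.mon_zero (R.gen x)]
      exact hword0 x 0 hx
  have hstep : ∀ x, U ≤ U.comap (LieAlgebra.ad F Q (R.gen x)) := by
    intro x
    refine sup_le (Submodule.span_le.2 ?_) (iSup_le fun m => Submodule.span_le.2 ?_)
    · rintro _ ⟨i, rfl⟩
      change ⁅R.gen x, R.gen (0, i)⁆ ∈ U
      by_cases hx : x.1 = 0
      · obtain ⟨g, j⟩ := x
        obtain rfl : g = 0 := hx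
        rw [R.lie_gen_zero]
        exact U.zero_mem
      · rw [← lie_skew, ← R.mon_single]
        exact U.neg_mem (hword0 x _ hx)
    · rintro _ ⟨⟨z, s⟩, hz, rfl⟩
      change ⁅R.gen x, R.letterWord m (z, s)⁆ ∈ U
      by_cases hx : x.1 = 0
      · obtain ⟨g, j⟩ := x
        obtain rfl : g = 0 := hx
        rw [letterWord, lie_word]
        refine U.sum_mem fun i _ => ?_
        have : Function.update (fun i => R.mon (s i) (R.gen (z i))) i
            ⁅R.gen (0, j), R.mon (s i) (R.gen (z i))⁆ = fun k =>
            R.mon (Function.update s i (Finsupp.single j 1 + s i) k) (R.gen (z k)) := by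
          funext k
          by_cases hk : k = i
          · subst hk
            simp [mon_add, mon_single]
          · simp [hk]
        rw [this]
        exact hword m z _ hz
      · have := hword (m + 1) (Fin.cons x z) (Fin.cons 0 s) (by
          intro i
          refine Fin.cases ?_ (fun j => ?_) i
          · exact hx
          · exact hz j)
        rw [letterWord, word] at this
        simpa [Fin.tail_def, mon_zero, letterWord] using this
  have : U = ⊤ := R.eq_top U hgen fun x u hu => hstep x hu
  rw [this]
  exact Submodule.mem_top

end RelativelyFree
end GradedSpecht

/-! ### Homogeneous components and multilinear words -/

namespace GradedSpecht

/-- Over an infinite field, a subspace that contains all the values of a polynomial with vector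
coefficients contains its coefficients. -/
theorem sum_coeff_mem {F V σ A : Type*} [Field F] [Infinite F] [AddCommGroup V] [Module F V]
    (W : Submodule F V) (s : Finset A) (e : A → σ →₀ ℕ) (v : A → V)
    (h : ∀ c : σ → F, ∑ a ∈ s, ((e a).prod fun j k => c j ^ k) • v a ∈ W) (e₀ : σ →₀ ℕ)
    [DecidablePred fun a => e a = e₀] :
    ∑ a ∈ s with e a = e₀, v a ∈ W := by
  classical
  by_contra hcon
  -- A functional killing `W` but not the coefficient gives a polynomial vanishing as a function on
  -- an infinite field, hence zero.
  obtain ⟨f, hf, hW⟩ := Submodule.exists_le_ker_of_notMem hcon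
  have hP : ∑ a ∈ s, MvPolynomial.monomial (e a) (f (v a)) = 0 := by
    refine MvPolynomial.funext fun c => ?_
    have := LinearMap.mem_ker.1 (hW (h c))
    simp only [map_sum, map_smul, smul_eq_mul] at this
    simp only [map_sum, MvPolynomial.eval_monomial, map_zero]
    rw [← this]
    exact Finset.sum_congr rfl fun a _ => mul_comm _ _
  apply hf
  have := congrArg (MvPolynomial.coeff e₀) hP
  rw [Finset.sum_filter, map_sum]
  simp only [MvPolynomial.coeff_sum, MvPolynomial.coeff_monomial, MvPolynomial.coeff_zero] at this
  simp only [apply_ite f, map_zero]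
  convert this

namespace RelativelyFree

variable {F : Type*} [Field F] {G : Type*} [AddCommGroup G]
  {Q : Type*} [LieRing Q] [LieAlgebra F Q] {N : ℕ} (R : RelativelyFree F G Q N)

variable {R} in
lemma Stable.exists_hom {V : Submodule F Q} (hV : R.Stable V) (a : G × ℕ → Q)
    (ha : ∀ x, a x ∈ R.comp x.1) :
    ∃ φ : Q →ₗ⁅F⁆ Q, (∀ x, φ (R.gen x) = a x) ∧ ∀ v ∈ V, φ v ∈ V := by
  obtain ⟨φ, hφ⟩ := R.exists_hom a ha
  exact ⟨φ, hφ, hV φ fun x => by rw [hφ]; exact ha x⟩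

lemma exists_hom_stable (a : G × ℕ → Q) (ha : ∀ x, a x ∈ R.comp x.1) :
    ∃ φ : Q →ₗ⁅F⁆ Q, (∀ x, φ (R.gen x) = a x) ∧
      ∀ V : Submodule F Q, R.Stable V → ∀ v ∈ V, φ v ∈ V := by
  obtain ⟨φ, hφ⟩ := R.exists_hom a ha
  exact ⟨φ, hφ, fun V hV => hV φ fun x => by rw [hφ]; exact ha x⟩

/-- A stable subspace that meets the span of the generators of degree `0` contains it. -/
lemma exists_basis_linearPart (V : Submodule F Q) (hV : R.Stable V) :
    ∃ S : Set Q, S.Finite ∧ S ⊆ V ∧ ∀ V' : Submodule F Q, R.Stable V' → S ⊆ V' →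
      V ⊓ R.linearPart ≤ V' := by
  classical
  -- If `V` contains a nonzero linear combination, sending one of its variables to `gen (0, 0)` and
  -- the others to `0` puts `gen (0, 0)` in `V`; renaming then recovers every generator of degree
  -- `0`.
  refine ⟨{x | x = R.gen (0, 0) ∧ x ∈ V}, (Set.finite_singleton (R.gen (0, 0))).subset
    fun x hx => hx.1, fun x hx => hx.2, fun V' hV' hS => ?_⟩
  rintro x ⟨hxV, hx⟩
  obtain ⟨c, rfl⟩ := (Finsupp.mem_span_range_iff_exists_finsupp).1 hx
  by_cases hc : c = 0
  · simp [hc]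
  obtain ⟨k, hk⟩ := Finsupp.ne_iff.1 hc
  have hgen : R.gen (0, 0) ∈ V' := by
    refine hS ⟨rfl, ?_⟩
    obtain ⟨φ, hφ, hφV⟩ := hV.exists_hom
      (fun x => if x = (0, k) then R.gen (0, 0) else 0) (by
        intro x
        split_ifs with h
        · rw [h]; exact R.gen_mem (0, 0)
        · exact Submodule.zero_mem _)
    have h1 := hφV _ hxV
    have h2 : φ (c.sum fun i a => a • R.gen (0, i)) = c k • R.gen (0, 0) := by
      rw [Finsupp.sum, map_sum, Finset.sum_eq_single k]
      · rw [map_smul, hφ, if_pos rfl]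
      · intro i _ hik
        rw [map_smul, hφ, if_neg (by simpa using hik), smul_zero]
      · intro hk'
        rw [Finsupp.notMem_support_iff.1 hk', zero_smul, map_zero]
    change φ (c.sum fun i a => a • R.gen (0, i)) ∈ V at h1
    rw [h2] at h1
    exact (V.smul_mem_iff hk).1 h1
  refine V'.sum_mem fun i _ => V'.smul_mem _ ?_
  obtain ⟨φ, hφ, hφV⟩ := hV'.exists_hom
    (fun x => if x = (0, 0) then R.gen (0, i) else 0) (by
      intro x
      split_ifs with h
      · rw [h]; exact R.gen_mem (0, i)
      · exact Submodule.zero_mem _)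
  have := hφV _ hgen
  rwa [hφ, if_pos rfl] at this

/-- The multilinear words in the letters `(g 0, 0), …, (g m, m)`, indexed by the order of the
letters and the monomials acting on them. -/
noncomputable def multilinearEval (m : ℕ) (g : Fin (m + 1) → G) :
    (Equiv.Perm (Fin (m + 1)) × (Fin (m + 1) → ℕ →₀ ℕ) →₀ F) →ₗ[F] Q :=
  Finsupp.linearCombination F fun a =>
    R.letterWord m (fun i => (g (a.1 i), (a.1 i : ℕ)), fun i => a.2 (a.1 i))

/-- Shift the degree `0` generators by `t` and multiply letter `j` by the monomial `u j`. Exponents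
are attached to letters, not positions, so one substitution serves all permutations. -/
lemma exists_hom_shiftAdd (m : ℕ) (g : Fin (m + 1) → G) (hg : ∀ i, g i ≠ 0) (t : ℕ → ℕ)
    (u : Fin (m + 1) → ℕ →₀ ℕ) : ∃ φ : Q →ₗ⁅F⁆ Q,
      (∀ V : Submodule F Q, R.Stable V → ∀ v ∈ V, φ v ∈ V) ∧
      ∀ p, φ (R.multilinearEval m g p) = R.multilinearEval m g (p.mapDomain (shiftAdd t u)) := by
  classical
  obtain ⟨φ, hφ, hφV⟩ := R.exists_hom_stable
    (fun x => if x.1 = 0 then R.gen (x.1, t x.2) else if h : x.2 < m + 1 then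
      R.mon (u ⟨x.2, h⟩) (R.gen x) else R.gen x) (by
      intro x
      split_ifs with h h'
      · exact R.gen_mem (x.1, t x.2)
      · exact R.act_mem _ (R.gen_mem _)
      · exact R.gen_mem _)
  refine ⟨φ, hφV, fun p => ?_⟩
  have h0 : ∀ i, φ (R.gen (0, i)) = R.gen (0, t i) := fun i => by rw [hφ, if_pos rfl]
  have h1 : ∀ j : Fin (m + 1), φ (R.gen (g j, (j : ℕ))) = R.mon (u j) (R.gen (g j, (j : ℕ))) :=
    fun j => by rw [hφ, if_neg (hg j), dif_pos j.2]
  rw [multilinearEval, Finsupp.linearCombination_mapDomain, Finsupp.linearCombination_apply,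
    Finsupp.linearCombination_apply, Finsupp.sum, Finsupp.sum, map_sum]
  refine Finset.sum_congr rfl fun a _ => ?_
  rw [map_smul, Function.comp, letterWord, map_word]
  congr 2
  funext i
  dsimp only [shiftAdd]
  rw [R.map_mon φ t h0, h1, mon_add]

/-- Cohen's theorem is applied to the preimage of `V` in the coordinate space, so the multilinear
words need not be linearly independent. -/
lemma exists_basis_multilinear (m : ℕ) (g : Fin (m + 1) → G) (hg : ∀ i, g i ≠ 0)
    (V : Submodule F Q) (hV : R.Stable V) :
    ∃ S : Set Q, S.Finite ∧ S ⊆ V ∧ ∀ V' : Submodule F Q, R.Stable V' → S ⊆ V' →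
      V ⊓ LinearMap.range (R.multilinearEval m g) ≤ V' := by
  have key : ∀ W : Submodule F Q, R.Stable W → ∀ t u, StrictMono t →
      ∀ p ∈ W.comap (R.multilinearEval m g),
        p.mapDomain (shiftAdd t u) ∈ W.comap (R.multilinearEval m g) := by
    intro W hW t u _ p hp
    obtain ⟨φ, h1, h2⟩ := R.exists_hom_shiftAdd m g hg t u
    rw [Submodule.mem_comap, ← h2]
    exact h1 W hW _ hp
  obtain ⟨S, h1, h2, h3⟩ := exists_finite_basis_shiftAdd F _ (key V hV)
  refine ⟨R.multilinearEval m g '' S, h1.image _, ?_, fun V' hV' hS => ?_⟩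
  · rintro _ ⟨p, hp, rfl⟩
    exact h2 hp
  · rintro _ ⟨hx, p, rfl⟩
    exact h3 _ (key V' hV') (fun p hp => hS ⟨p, hp, rfl⟩) hx

/-- A stable subspace contains the components of its elements of each length. -/
lemma mem_of_length_components [Infinite F] (V : Submodule F Q) (hV : R.Stable V) (l : Q)
    (hl : l ∈ R.linearPart) (w : Fin N → Q) (hw : ∀ m : Fin N, w m ∈ R.wordPart m)
    (h : l + ∑ m, w m ∈ V) : l ∈ V ∧ ∀ m, w m ∈ V := by
  classical
  -- Weight in the scalar `c` multiplying the generators of nonzero degree: `0` on the linear part,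
  -- the length `m + 1` on words.
  set e : Option (Fin N) → Unit →₀ ℕ :=
    fun a => a.elim 0 fun m => Finsupp.single () ((m : ℕ) + 1) with he
  set v : Option (Fin N) → Q := fun a => a.elim l w with hv
  have main := sum_coeff_mem V Finset.univ e v (by
    intro c
    obtain ⟨φ, hφ, hφV⟩ := hV.exists_hom
      (fun x => (if x.1 = 0 then 1 else c ()) • R.gen x)
      (fun x => (R.comp x.1).smul_mem _ (R.gen_mem x))
    have h0 : ∀ i, φ (R.gen (0, i)) = R.gen (0, i) := fun i => by
      rw [hφ, if_pos rfl, one_smul]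
    have hφl : φ l = l := by
      have : R.linearPart ≤ LinearMap.eqLocus (φ : Q →ₗ[F] Q) LinearMap.id := by
        refine Submodule.span_le.2 ?_
        rintro _ ⟨i, rfl⟩
        exact h0 i
      exact this hl
    have hφw : ∀ m, φ (w m) = c () ^ ((m : ℕ) + 1) • w m := by
      intro m
      have : R.wordPart m ≤ LinearMap.eqLocus (φ : Q →ₗ[F] Q)
          (c () ^ ((m : ℕ) + 1) • LinearMap.id) := by
        refine Submodule.span_le.2 ?_
        rintro _ ⟨⟨z, s⟩, hz, rfl⟩
        change φ (R.letterWord m (z, s)) = c () ^ ((m : ℕ) + 1) • R.letterWord m (z, s)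
        rw [letterWord, map_word]
        have : (fun i => φ (R.mon (s i) (R.gen (z i)))) =
            fun i => c () • R.mon (s i) (R.gen (z i)) := by
          funext i
          rw [R.map_mon_of_fixed φ h0, hφ, if_neg (hz i), map_smul]
        dsimp only
        rw [this, word_smul F]
        simp
      exact this (hw m)
    have := hφV _ h
    rw [map_add, map_sum, hφl] at this
    simp only [hφw] at this
    rw [Fintype.sum_option]
    simpa [he, hv] using this)
  constructor
  · have := main 0
    rw [Finset.sum_filter, Fintype.sum_option, Finset.sum_eq_zero] at this
    · simpa [he, hv] using this
    · intro m _
      rw [if_neg]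
      simp [he]
  · intro m
    have := main (Finsupp.single () ((m : ℕ) + 1))
    rw [Finset.sum_filter, Fintype.sum_option, if_neg, zero_add, Finset.sum_eq_single m,
      if_pos (show e (some m) = Finsupp.single () ((m : ℕ) + 1) from rfl)] at this
    · exact this
    · intro k _ hk
      rw [if_neg]
      simpa [he, Fin.ext_iff] using hk
    · simp
    · intro h
      have := DFunLike.congr_fun h ()
      simp [he] at this

end RelativelyFree
end GradedSpecht

/-! ### Polarization and finite generation of stable subspaces -/

namespace GradedSpecht
namespace RelativelyFree

variable {F : Type*} [Field F] {G : Type*} [AddCommGroup G]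
  {Q : Type*} [LieRing Q] [LieAlgebra F Q] {N : ℕ} (R : RelativelyFree F G Q N)

/-- This identifies the choices contributing to the coefficient of the multilinear monomial: each
index is used exactly once. -/
lemma filter_sum_single_eq_map {k : ℕ} [DecidablePred fun κ : Fin k → Fin k =>
      ∑ i, Finsupp.single (κ i) 1 = (∑ i, Finsupp.single i 1 : Fin k →₀ ℕ)] :
    (Finset.univ.filter fun κ : Fin k → Fin k =>
      ∑ i, Finsupp.single (κ i) 1 = (∑ i, Finsupp.single i 1 : Fin k →₀ ℕ)) =
    (Finset.univ : Finset (Equiv.Perm (Fin k))).map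
      ⟨fun σ : Equiv.Perm (Fin k) => (σ : Fin k → Fin k), DFunLike.coe_injective⟩ := by
  classical
  ext κ
  simp only [Finset.mem_filter, Finset.mem_univ, true_and, Finset.mem_map,
    Function.Embedding.coeFn_mk]
  constructor
  · intro h
    have hsurj : Function.Surjective κ := by
      intro j
      by_contra! hj
      have := DFunLike.congr_fun h j
      simp [Finsupp.finsetSum_apply, Finsupp.single_apply, hj] at this
    exact ⟨Equiv.ofBijective κ (Finite.surjective_iff_bijective.1 hsurj), rfl⟩
  · rintro ⟨σ, rfl⟩
    exact Equiv.sum_comp σ fun i => (Finsupp.single i 1 : Fin k →₀ ℕ)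

/-- Polarization of a combination of words of length `m + 1` at the letters `z`: a stable subspace
contains the multilinear component obtained by substituting for each letter `y` the sum of the new
letters `((z j).1, j)` with `z j = y`. -/
lemma polarization_mem [Infinite F] (V : Submodule F Q) (hV : R.Stable V) (m : ℕ)
    (c : (Fin (m + 1) → G × ℕ) × (Fin (m + 1) → ℕ →₀ ℕ) →₀ F)
    (hc : ∀ a ∈ c.support, ∀ i, (a.1 i).1 ≠ 0)
    (hcV : Finsupp.linearCombination F (R.letterWord m) c ∈ V) (z : Fin (m + 1) → G × ℕ)
    [DecidableEq (Fin (m + 1) → G × ℕ)] :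
    ∑ σ : Equiv.Perm (Fin (m + 1)), ∑ a ∈ c.support, (if z ∘ σ = a.1 then c a •
      R.letterWord m (fun i => ((z (σ i)).1, (σ i : ℕ)), a.2) else 0) ∈ V := by
  classical
  have main := sum_coeff_mem V Finset.univ
    (fun κ : Fin (m + 1) → Fin (m + 1) => ∑ i, Finsupp.single (κ i) 1)
    (fun κ => ∑ a ∈ c.support, (if z ∘ κ = a.1 then c a •
      R.letterWord m (fun i => ((z (κ i)).1, (κ i : ℕ)), a.2) else 0)) (by
    intro l
    -- The scalars `l j` mark the new letters, and expanding yields one term per choice `κ` of new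
    -- letters.
    obtain ⟨φ, hφ, hφV⟩ := hV.exists_hom (fun x => if x.1 = 0 then R.gen x else
        ∑ j, (if z j = x then l j else 0) • R.gen ((z j).1, j)) (by
      intro x
      split_ifs with h
      · exact R.gen_mem x
      · refine Submodule.sum_mem _ fun j _ => ?_
        split_ifs with h'
        · rw [← h']
          exact Submodule.smul_mem _ _ (R.gen_mem ((z j).1, (j : ℕ)))
        · rw [zero_smul]; exact Submodule.zero_mem _)
    have h0 : ∀ i, φ (R.gen (0, i)) = R.gen (0, i) := fun i => by rw [hφ, if_pos rfl]
    have hword : ∀ a ∈ c.support, φ (R.letterWord m a) =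
        ∑ κ : Fin (m + 1) → Fin (m + 1), (if z ∘ κ = a.1 then
          (∏ i, l (κ i)) • R.letterWord m (fun i => ((z (κ i)).1, (κ i : ℕ)), a.2) else 0) := by
      intro a ha
      have h1 : ∀ i, φ (R.mon (a.2 i) (R.gen (a.1 i))) =
          ∑ j, (if z j = a.1 i then l j else 0) • R.mon (a.2 i) (R.gen ((z j).1, j)) := by
        intro i
        rw [R.map_mon_of_fixed φ h0, hφ, if_neg (hc a ha i), map_sum]
        simp only [map_smul]
      rw [letterWord, map_word]
      simp only [h1]
      rw [word_sum F]
      refine Finset.sum_congr rfl fun κ _ => ?_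
      rw [word_smul F, Finset.prod_ite_zero]
      simp only [funext_iff, Function.comp, Finset.mem_univ, true_imp_iff, ite_smul, zero_smul]
      rfl
    have hmem := hφV _ hcV
    rw [Finsupp.linearCombination_apply, Finsupp.sum, map_sum] at hmem
    convert hmem using 1
    have : ∀ a ∈ c.support, φ (c a • R.letterWord m a) =
        ∑ κ : Fin (m + 1) → Fin (m + 1), (∏ i, l (κ i)) • (if z ∘ κ = a.1 then
          c a • R.letterWord m (fun i => ((z (κ i)).1, (κ i : ℕ)), a.2) else 0) := by
      intro a ha
      rw [map_smul, hword a ha, Finset.smul_sum]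
      refine Finset.sum_congr rfl fun κ _ => ?_
      split_ifs
      · rw [smul_comm]
      · rw [smul_zero, smul_zero]
    rw [Finset.sum_congr rfl this, Finset.sum_comm]
    refine Finset.sum_congr rfl fun κ _ => ?_
    rw [← Finset.smul_sum]
    congr 1
    rw [← Finsupp.prod_finsetSum_index]
    · simp
    · simp
    · intro j k k'
      exact pow_add _ _ _) (∑ i, Finsupp.single i 1)
  rw [filter_sum_single_eq_map, Finset.sum_map] at main
  exact main

/-- The words of a fixed length: a stable subspace is determined by its multilinear elements if the
factorial of the length is invertible. -/
lemma mem_of_multilinear [Infinite F] (V V' : Submodule F Q) (hV : R.Stable V) (hV' : R.Stable V')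
    (m : ℕ) (hm : ((m + 1).factorial : F) ≠ 0)
    (h : ∀ g : Fin (m + 1) → G, (∀ i, g i ≠ 0) →
      V ⊓ LinearMap.range (R.multilinearEval m g) ≤ V') : V ⊓ R.wordPart m ≤ V' := by
  classical
  rintro f ⟨hfV, hf⟩
  obtain ⟨c, hc, rfl⟩ := (Finsupp.mem_span_image_iff_linearCombination F).1 hf
  replace hc : ∀ a ∈ c.support, ∀ i, (a.1 i).1 ≠ 0 := fun a ha =>
    (Finsupp.mem_supported F c).1 hc ha
  set Y : Finset (G × ℕ) := c.support.biUnion fun a => Finset.univ.image a.1 with hY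
  have hYmem : ∀ a ∈ c.support, ∀ i, a.1 i ∈ Y := fun a ha i =>
    Finset.mem_biUnion.2 ⟨a, ha, Finset.mem_image_of_mem _ (Finset.mem_univ i)⟩
  have hY0 : ∀ y ∈ Y, y.1 ≠ 0 := by
    intro y hy
    obtain ⟨a, ha, hy⟩ := Finset.mem_biUnion.1 hy
    obtain ⟨i, -, rfl⟩ := Finset.mem_image.1 hy
    exact hc a ha i
  have hz : ∀ z ∈ Fintype.piFinset fun _ : Fin (m + 1) => Y,
      ∑ σ : Equiv.Perm (Fin (m + 1)), ∑ a ∈ c.support,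
        (if z ∘ σ = a.1 then c a • R.letterWord m a else 0) ∈ V' := by
    intro z hz
    have hz0 : ∀ j, (z j).1 ≠ 0 := fun j => hY0 _ (Fintype.mem_piFinset.1 hz j)
    have h1 := R.polarization_mem V hV m c hc hfV z
    have h2 := h (fun j => (z j).1) hz0 ⟨h1, by
      refine Submodule.sum_mem _ fun σ _ => Submodule.sum_mem _ fun a _ => ?_
      split_ifs
      · refine Submodule.smul_mem _ _ ⟨Finsupp.single (σ, fun i => a.2 (σ.symm i)) 1, ?_⟩
        rw [multilinearEval, Finsupp.linearCombination_single, one_smul]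
        simp
      · exact Submodule.zero_mem _⟩
    -- Undo the polarization by sending the new letter `j` back to `z j`.
    obtain ⟨φ, hφ, hφV⟩ := hV'.exists_hom
      (fun x => if h : ∃ j : Fin (m + 1), x = ((z j).1, (j : ℕ)) then R.gen (z h.choose)
        else R.gen x) (by
        intro x
        split_ifs with h
        · have := congrArg Prod.fst h.choose_spec
          rw [this]
          exact R.gen_mem (z h.choose)
        · exact R.gen_mem x)
    have h0 : ∀ i, φ (R.gen (0, i)) = R.gen (0, i) := by
      intro i
      rw [hφ, dif_neg]
      rintro ⟨j, hj⟩
      exact hz0 j (congrArg Prod.fst hj).symm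
    have hj : ∀ j : Fin (m + 1), φ (R.gen ((z j).1, (j : ℕ))) = R.gen (z j) := by
      intro j
      have hex : ∃ k : Fin (m + 1), ((z j).1, (j : ℕ)) = ((z k).1, (k : ℕ)) := ⟨j, rfl⟩
      have hk : hex.choose = j := Fin.ext (congrArg Prod.snd hex.choose_spec).symm
      rw [hφ, dif_pos hex, hk]
    have h3 := hφV _ h2
    rw [map_sum] at h3
    convert h3 using 1
    refine Finset.sum_congr rfl fun σ _ => ?_
    rw [map_sum]
    refine Finset.sum_congr rfl fun a _ => ?_
    by_cases hσ : z ∘ σ = a.1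
    · rw [if_pos hσ, if_pos hσ, map_smul, letterWord, letterWord, map_word]
      congr 2
      funext i
      rw [R.map_mon_of_fixed φ h0, hj, ← hσ, Function.comp]
    · rw [if_neg hσ, if_neg hσ, map_zero]
  have hsum := V'.sum_mem hz
  -- For fixed `σ`, each word `a` is met by exactly one `z`, namely `a.1 ∘ σ.symm`. So every
  -- permutation contributes the whole element.
  have key : ∑ z ∈ Fintype.piFinset fun _ : Fin (m + 1) => Y,
      ∑ σ : Equiv.Perm (Fin (m + 1)), ∑ a ∈ c.support,
        (if z ∘ σ = a.1 then c a • R.letterWord m a else 0) =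
      ((m + 1).factorial : F) • Finsupp.linearCombination F (R.letterWord m) c := by
    rw [Finset.sum_comm]
    have : ∀ σ : Equiv.Perm (Fin (m + 1)), ∑ z ∈ Fintype.piFinset fun _ : Fin (m + 1) => Y,
        ∑ a ∈ c.support, (if z ∘ σ = a.1 then c a • R.letterWord m a else 0) =
        Finsupp.linearCombination F (R.letterWord m) c := by
      intro σ
      rw [Finset.sum_comm, Finsupp.linearCombination_apply, Finsupp.sum]
      refine Finset.sum_congr rfl fun a ha => ?_
      rw [Finset.sum_eq_single (a.1 ∘ σ.symm), if_pos]
      · ext i <;> simp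
      · intro z _ hne
        rw [if_neg]
        intro heq
        apply hne
        rw [← heq]
        ext i <;> simp
      · intro hn
        exact absurd (Fintype.mem_piFinset.2 fun i => hYmem a ha _) hn
    simp only [this]
    rw [Finset.sum_const, Finset.card_univ, Fintype.card_perm, Fintype.card_fin,
      Nat.cast_smul_eq_nsmul]
  rw [key] at hsum
  exact (V'.smul_mem_iff hm).1 hsum

/-- Every stable subspace of a relatively free algebra is generated by finitely many elements. -/
theorem exists_finite_basis [Finite G] [Infinite F]
    (hN : ∀ m < N, ((m + 1).factorial : F) ≠ 0) (V : Submodule F Q) (hV : R.Stable V) :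
    ∃ S : Set Q, S.Finite ∧ S ⊆ V ∧
      ∀ V' : Submodule F Q, R.Stable V' → S ⊆ V' → V ≤ V' := by
  obtain ⟨S₀, h1, h2, h3⟩ := R.exists_basis_linearPart V hV
  choose S hS1 hS2 hS3 using fun (m : Fin N) (g : {g : Fin ((m : ℕ) + 1) → G // ∀ i, g i ≠ 0}) =>
    R.exists_basis_multilinear m g.1 g.2 V hV
  refine ⟨S₀ ∪ ⋃ m, ⋃ g, S m g, h1.union (Set.finite_iUnion fun m => Set.finite_iUnion (hS1 m)),
    Set.union_subset h2 (Set.iUnion_subset fun m => Set.iUnion_subset (hS2 m)),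
    fun V' hV' hsub x hx => ?_⟩
  obtain ⟨l, hl, w, hw, rfl⟩ := Submodule.mem_sup.1 (R.mem_sup x)
  obtain ⟨w, hw', rfl⟩ := (Submodule.mem_iSup_iff_exists_finsupp _ _).1 hw
  rw [Finsupp.sum_fintype _ _ fun _ => rfl] at hx ⊢
  obtain ⟨h4, h5⟩ := R.mem_of_length_components V hV l hl w hw' hx
  refine V'.add_mem (h3 V' hV' (fun y hy => hsub (Or.inl hy)) ⟨h4, hl⟩) (V'.sum_mem fun m _ => ?_)
  refine R.mem_of_multilinear V V' hV hV' m (hN m m.2) (fun g hg => ?_) ⟨h5 m, hw' m⟩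
  exact hS3 m ⟨g, hg⟩ V' hV' fun y hy => hsub (Or.inr (Set.mem_iUnion₂.2 ⟨m, ⟨g, hg⟩, hy⟩))

end RelativelyFree
end GradedSpecht

namespace GradedSpecht

/-! ### Passage from the free algebra to the quotient by the basic identities -/

section FreeAlgebra

variable {F : Type*} [Field F] {G : Type*} [AddCommGroup G]

lemma mem_of_forall_of_mem {X : Type*} (H : LieSubalgebra F (FreeLieAlgebra F X))
    (hH : ∀ x, FreeLieAlgebra.of F x ∈ H) (a : FreeLieAlgebra F X) : a ∈ H := by
  have h : H.incl.comp (FreeLieAlgebra.lift F fun x => (⟨_, hH x⟩ : H)) = LieHom.id :=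
    FreeLieAlgebra.hom_ext fun x => by simp
  have := LieHom.congr_fun h a
  rw [LieHom.comp_apply, LieHom.id_apply] at this
  rw [← this]
  exact Subtype.property _

lemma of_mem_freeComponent (x : G × ℕ) : FreeLieAlgebra.of F x ∈ freeComponent F x.1 :=
  Submodule.subset_span (IsMonomialOfDegree.of x.1 x.2)

lemma lie_mem_freeComponent {g h : G} {a b : FreeGradedLie F G} (ha : a ∈ freeComponent F g)
    (hb : b ∈ freeComponent F h) : ⁅a, b⁆ ∈ freeComponent F (g + h) := by
  induction ha using Submodule.span_induction with
  | zero => rw [zero_lie]; exact Submodule.zero_mem _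
  | add x y _ _ hx hy => rw [add_lie]; exact Submodule.add_mem _ hx hy
  | smul c x _ hx => rw [smul_lie]; exact Submodule.smul_mem _ _ hx
  | mem x hx =>
    induction hb using Submodule.span_induction with
    | zero => rw [lie_zero]; exact Submodule.zero_mem _
    | add y z _ _ hy hz => rw [lie_add]; exact Submodule.add_mem _ hy hz
    | smul c y _ hy => rw [lie_smul]; exact Submodule.smul_mem _ _ hy
    | mem y hy => exact Submodule.subset_span (IsMonomialOfDegree.lie hx hy)

lemma isGradedEndomorphism_lift (a : G × ℕ → FreeGradedLie F G)
    (ha : ∀ x, a x ∈ freeComponent F x.1) : IsGradedEndomorphism (FreeLieAlgebra.lift F a) := by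
  intro g
  refine Submodule.span_le (p := (freeComponent F g).comap
    (FreeLieAlgebra.lift F a : FreeGradedLie F G →ₗ[F] FreeGradedLie F G)).2 fun m hm => ?_
  change FreeLieAlgebra.lift F a m ∈ freeComponent F g
  induction hm with
  | of g i => rw [FreeLieAlgebra.lift_of_apply]; exact ha (g, i)
  | lie _ _ h1 h2 => rw [LieHom.map_lie]; exact lie_mem_freeComponent h1 h2

/-- Closure of an ideal of the free algebra under the graded endomorphisms. -/
def IsEndoClosed (K : LieIdeal F (FreeGradedLie F G)) : Prop :=
  ∀ φ : FreeGradedLie F G →ₗ⁅F⁆ FreeGradedLie F G, IsGradedEndomorphism φ → ∀ f ∈ K, φ f ∈ K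

variable (F G) in
/-- The commutator of two variables of degree `0` and the right-normed brackets of `N + 1`
variables of nonzero degree. -/
def basicIdentities (N : ℕ) : Set (FreeGradedLie F G) :=
  insert ⁅FreeLieAlgebra.of F ((0 : G), 0), FreeLieAlgebra.of F ((0 : G), 1)⁆
    ((fun z : Fin (N + 1) → G => word N fun i => FreeLieAlgebra.of F (z i, (i : ℕ))) ''
      {z | ∀ i, z i ≠ 0})

lemma finite_basicIdentities [Finite G] (N : ℕ) : (basicIdentities F G N).Finite :=
  ((Set.toFinite _).image _).insert _

variable (F G) in
/-- The least ideal that contains the basic identities and is closed under the graded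
endomorphisms. -/
noncomputable def basicIdeal (N : ℕ) : LieIdeal F (FreeGradedLie F G) :=
  sInf {K | IsEndoClosed K ∧ basicIdentities F G N ⊆ K}

lemma mem_basicIdeal {N : ℕ} {f : FreeGradedLie F G} : f ∈ basicIdeal F G N ↔
    ∀ K : LieIdeal F (FreeGradedLie F G), IsEndoClosed K → basicIdentities F G N ⊆ K → f ∈ K := by
  rw [basicIdeal, ← SetLike.mem_coe, LieSubmodule.coe_sInf]
  simp

lemma basicIdeal_le {N : ℕ} {K : LieIdeal F (FreeGradedLie F G)} (hK : IsEndoClosed K)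
    (h : basicIdentities F G N ⊆ K) : basicIdeal F G N ≤ K :=
  fun _ hf => mem_basicIdeal.1 hf K hK h

lemma basicIdentities_subset (N : ℕ) : basicIdentities F G N ⊆ basicIdeal F G N :=
  fun _ hf => mem_basicIdeal.2 fun _ _ h => h hf

lemma isEndoClosed_basicIdeal (N : ℕ) : IsEndoClosed (basicIdeal F G N) :=
  fun φ hφ f hf => mem_basicIdeal.2 fun K hK h => hK φ hφ f (mem_basicIdeal.1 hf K hK h)

variable (F G) in
/-- The projection of the free algebra onto the quotient by the basic ideal. -/
noncomputable def basicProj (N : ℕ) : FreeGradedLie F G →ₗ⁅F⁆ (FreeGradedLie F G ⧸ basicIdeal F G N) where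
  toFun := LieSubmodule.Quotient.mk
  map_add' := fun _ _ => rfl
  map_smul' := fun _ _ => rfl
  map_lie' := rfl

lemma basicProj_surjective (N : ℕ) : Function.Surjective (basicProj F G N) :=
  LieSubmodule.Quotient.surjective_mk' _

lemma basicProj_eq_zero_iff (N : ℕ) (f : FreeGradedLie F G) :
    basicProj F G N f = 0 ↔ f ∈ basicIdeal F G N :=
  LieSubmodule.Quotient.mk_eq_zero'

lemma exists_quotient_hom (N : ℕ) (φ : FreeGradedLie F G →ₗ⁅F⁆ FreeGradedLie F G)
    (hφ : IsGradedEndomorphism φ) :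
    ∃ ψ : (FreeGradedLie F G ⧸ basicIdeal F G N) →ₗ⁅F⁆ (FreeGradedLie F G ⧸ basicIdeal F G N),
      ∀ f, ψ (basicProj F G N f) = basicProj F G N (φ f) := by
  let ψ : (FreeGradedLie F G ⧸ basicIdeal F G N) →ₗ[F] (FreeGradedLie F G ⧸ basicIdeal F G N) :=
    (basicIdeal F G N).toSubmodule.mapQ (basicIdeal F G N).toSubmodule
    (φ : FreeGradedLie F G →ₗ[F] FreeGradedLie F G) fun f hf => isEndoClosed_basicIdeal N φ hφ f hf
  have hψ : ∀ f, ψ (basicProj F G N f) = basicProj F G N (φ f) := fun f => rfl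
  refine ⟨{ ψ with map_lie' := ?_ }, hψ⟩
  intro x y
  obtain ⟨a, rfl⟩ := basicProj_surjective N x
  obtain ⟨b, rfl⟩ := basicProj_surjective N y
  refine ((congrArg ψ (LieHom.map_lie _ a b)).symm.trans (hψ _)).trans ?_
  rw [LieHom.map_lie, LieHom.map_lie]
  rfl

lemma exists_graded_lift (N : ℕ) (a : G × ℕ → FreeGradedLie F G ⧸ basicIdeal F G N)
    (ha : ∀ x, a x ∈ (freeComponent F x.1).map
      (basicProj F G N : FreeGradedLie F G →ₗ[F] FreeGradedLie F G ⧸ basicIdeal F G N)) :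
    ∃ φ : FreeGradedLie F G →ₗ⁅F⁆ FreeGradedLie F G, IsGradedEndomorphism φ ∧
      ∀ x, basicProj F G N (φ (FreeLieAlgebra.of F x)) = a x := by
  choose b hb hba using ha
  refine ⟨_, isGradedEndomorphism_lift b hb, fun x => ?_⟩
  rw [FreeLieAlgebra.lift_of_apply]
  exact hba x

variable (F G) in
/-- The quotient of the free algebra by the basic ideal as a relatively free algebra. -/
noncomputable def basicQuotient (N : ℕ) :
    RelativelyFree F G (FreeGradedLie F G ⧸ basicIdeal F G N) N where
  gen x := basicProj F G N (FreeLieAlgebra.of F x)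
  comp g := (freeComponent F g).map
    (basicProj F G N : FreeGradedLie F G →ₗ[F] FreeGradedLie F G ⧸ basicIdeal F G N)
  gen_mem x := ⟨_, of_mem_freeComponent x, rfl⟩
  lie_mem := by
    rintro g h _ _ ⟨a, ha, rfl⟩ ⟨b, hb, rfl⟩
    exact ⟨⁅a, b⁆, lie_mem_freeComponent ha hb, LieHom.map_lie _ _ _⟩
  lie_gen_zero i j := by
    classical
    have h := isEndoClosed_basicIdeal N (FreeLieAlgebra.lift F fun x : G × ℕ =>
      if x.2 = 0 then FreeLieAlgebra.of F (x.1, i) else FreeLieAlgebra.of F (x.1, j))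
      (isGradedEndomorphism_lift _ fun x => by
        split_ifs
        · exact of_mem_freeComponent (x.1, i)
        · exact of_mem_freeComponent (x.1, j)) _
      (basicIdentities_subset N (Set.mem_insert _ _))
    rw [LieHom.map_lie, FreeLieAlgebra.lift_of_apply, FreeLieAlgebra.lift_of_apply,
      if_pos rfl, if_neg one_ne_zero] at h
    rw [← LieHom.map_lie, basicProj_eq_zero_iff]
    exact h
  word_gen z hz := by
    rw [← map_word, basicProj_eq_zero_iff]
    exact basicIdentities_subset N (Set.mem_insert_of_mem _ ⟨z, hz, rfl⟩)
  exists_hom a ha := by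
    obtain ⟨φ, hφ, h⟩ := exists_graded_lift N a ha
    obtain ⟨ψ, hψ⟩ := exists_quotient_hom N φ hφ
    exact ⟨ψ, fun x => by rw [hψ, h]⟩
  eq_top U hgen hU := by
    -- The elements whose adjoint action preserves `U` form a subalgebra containing the variables,
    -- hence everything. The preimage of `U` is then itself a subalgebra containing the variables.
    let H : LieSubalgebra F (FreeGradedLie F G) :=
      { carrier := {a | ∀ u ∈ U, ⁅basicProj F G N a, u⁆ ∈ U}
        zero_mem' := fun u _ => by rw [map_zero, zero_lie]; exact U.zero_mem
        add_mem' := fun ha hb u hu => by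
          rw [map_add, add_lie]; exact U.add_mem (ha u hu) (hb u hu)
        smul_mem' := fun c a ha u hu => by
          rw [map_smul, smul_lie]; exact U.smul_mem _ (ha u hu)
        lie_mem' := fun ha hb u hu => by
          rw [LieHom.map_lie, lie_lie]
          exact U.sub_mem (ha _ (hb u hu)) (hb _ (ha u hu)) }
    have hH : ∀ a, a ∈ H := mem_of_forall_of_mem H hU
    let H' : LieSubalgebra F (FreeGradedLie F G) :=
      { U.comap (basicProj F G N : FreeGradedLie F G →ₗ[F] FreeGradedLie F G ⧸ basicIdeal F G N)
          with
        lie_mem' := fun {a b} _ hb => by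
          change basicProj F G N ⁅a, b⁆ ∈ U
          rw [LieHom.map_lie]
          exact hH a _ hb }
    have hH' : ∀ a, a ∈ H' := mem_of_forall_of_mem H' hgen
    refine eq_top_iff.2 fun q _ => ?_
    obtain ⟨a, rfl⟩ := basicProj_surjective N q
    exact hH' a

/-- A degree-preserving endomorphism of the quotient lifts to a graded endomorphism of the free
algebra: lift the images of the generators within their components. -/
lemma stable_map_basicProj (N : ℕ) (K : LieIdeal F (FreeGradedLie F G)) (hK : IsEndoClosed K) :
    (basicQuotient F G N).Stable (K.toSubmodule.map
      (basicProj F G N : FreeGradedLie F G →ₗ[F] FreeGradedLie F G ⧸ basicIdeal F G N)) := by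
  rintro ψ hψ _ ⟨f, hf, rfl⟩
  obtain ⟨φ, hφ, h⟩ := exists_graded_lift N (fun x => ψ (basicProj F G N (FreeLieAlgebra.of F x))) hψ
  have : (basicProj F G N).comp φ = ψ.comp (basicProj F G N) := FreeLieAlgebra.hom_ext h
  exact ⟨φ f, hK φ hφ f hf, LieHom.congr_fun this f⟩

/-- The Specht property for gradings by a finite group whose identities include the commutator of
two variables of degree `0` and the right-normed brackets of `N + 1` variables of nonzero degree. -/
theorem hasSpechtProperty_of_basicIdentities [Finite G] [Infinite F] {L : Type*} [LieRing L]
    [LieAlgebra F L] (𝒜 : G → Submodule F L) (N : ℕ)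
    (hN : ∀ m < N, ((m + 1).factorial : F) ≠ 0)
    (h : basicIdentities F G N ⊆ gradedIdentities 𝒜) : HasSpechtProperty 𝒜 := by
  intro J hJ hIJ
  have hBJ : basicIdentities F G N ⊆ J := fun f hf => hIJ (h hf)
  obtain ⟨S, hS1, hS2, hS3⟩ := (basicQuotient F G N).exists_finite_basis hN _
    (stable_map_basicProj N J hJ.map_mem)
  have hr : ∀ q ∈ S, ∃ f ∈ J, basicProj F G N f = q := fun q hq => hS2 hq
  choose! r hr using hr
  -- The basic identities generate the kernel of the projection, and `r` lifts the generators of the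
  -- image of `J`.
  refine ⟨basicIdentities F G N ∪ r '' S, (finite_basicIdentities N).union (hS1.image r),
    ⟨hJ, Set.union_subset hBJ ?_⟩, fun K hK f hf => ?_⟩
  · rintro _ ⟨q, hq, rfl⟩
    exact (hr q hq).1
  · obtain ⟨hK, hSK⟩ := hK
    have hBK : basicIdeal F G N ≤ K :=
      basicIdeal_le hK.map_mem (Set.subset_union_left.trans hSK)
    obtain ⟨k, hk, hkf⟩ := hS3 _ (stable_map_basicProj N K hK.map_mem)
      (fun q hq => ⟨r q, hSK (Or.inr ⟨q, hq, rfl⟩), (hr q hq).2⟩) ⟨f, hf, rfl⟩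
    have hfk : f - k ∈ K := by
      refine hBK ((basicProj_eq_zero_iff N _).1 ?_)
      rw [map_sub, sub_eq_zero]
      exact hkf.symm
    rw [← sub_add_cancel f k]
    exact K.add_mem hfk hk

end FreeAlgebra

/-! ### The basic identities hold for upper triangular matrices -/

section UpperTriangular

variable {n : ℕ} {F : Type*} [Field F]

lemma apply_eq_zero_of_mem_canonicalGrading [NeZero n] {k : ZMod n} {A : upperTriangularLie n F}
    (hA : A ∈ canonicalGrading F k) (i j : Fin n) (hij : (j : ℕ) ≠ i + k.val) :
    (A : Matrix (Fin n) (Fin n) F) i j = 0 := by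
  induction hA using Submodule.span_induction with
  | zero => rfl
  | add x y _ _ hx hy => rw [show ((x + y : upperTriangularLie n F) : Matrix (Fin n) (Fin n) F) = x + y from rfl,
       Matrix.add_apply, hx, hy, add_zero]
  | smul c x _ hx => rw [show ((c • x : upperTriangularLie n F) : Matrix (Fin n) (Fin n) F) = c • (x : Matrix _ _ F)
      from rfl,  Matrix.smul_apply, hx, smul_zero]
  | mem x hx =>
    obtain ⟨a, b, hab, hx⟩ := hx
    rw [hx, Matrix.single_apply_of_ne]
    rintro ⟨rfl, rfl⟩
    exact hij hab

/-- The filtration by distance above the diagonal is additive under products: an intermediate index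
`c` cannot satisfy both bounds. -/
lemma lie_apply_eq_zero {k l : ℕ} {A B : Matrix (Fin n) (Fin n) F}
    (hA : ∀ i j : Fin n, (j : ℕ) < i + k → A i j = 0)
    (hB : ∀ i j : Fin n, (j : ℕ) < i + l → B i j = 0) (i j : Fin n) (hij : (j : ℕ) < i + (k + l)) :
    ⁅A, B⁆ i j = 0 := by
  rw [Ring.lie_def, Matrix.sub_apply, Matrix.mul_apply, Matrix.mul_apply, Finset.sum_eq_zero,
    Finset.sum_eq_zero, sub_zero]
  · intro c _
    by_cases h : (c : ℕ) < i + l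
    · rw [hB i c h, zero_mul]
    · rw [hA c j (by omega), mul_zero]
  · intro c _
    by_cases h : (c : ℕ) < i + k
    · rw [hA i c h, zero_mul]
    · rw [hB c j (by omega), mul_zero]

lemma word_apply_eq_zero (m : ℕ) (v : Fin (m + 1) → upperTriangularLie n F)
    (hv : ∀ c, ∀ i j : Fin n, (j : ℕ) < i + 1 → (v c : Matrix (Fin n) (Fin n) F) i j = 0)
    (i j : Fin n) (hij : (j : ℕ) < i + (m + 1)) :
    ((word m v : upperTriangularLie n F) : Matrix (Fin n) (Fin n) F) i j = 0 := by
  induction m generalizing i j with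
  | zero => exact hv 0 i j hij
  | succ m ih =>
    rw [word, LieSubalgebra.coe_bracket]
    exact lie_apply_eq_zero (hv 0) (ih (Fin.tail v) fun c => hv _) i j (by omega)

lemma basicIdentities_subset_gradedIdentities [NeZero n] (N : ℕ) (hN : n = N + 1) :
    basicIdentities F (ZMod n) N ⊆ gradedIdentities (canonicalGrading (n := n) F) := by
  rintro f (rfl | ⟨z, hz, rfl⟩) a ha
  · have hdiag : ∀ i : ℕ, ∃ d : Fin n → F,
        (a (0, i) : Matrix (Fin n) (Fin n) F) = Matrix.diagonal d := fun i => by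
      refine ⟨fun r => (a (0, i) : Matrix (Fin n) (Fin n) F) r r, ?_⟩
      ext r c
      by_cases hrc : r = c
      · subst hrc; rw [Matrix.diagonal_apply_eq]
      · rw [Matrix.diagonal_apply_ne _ hrc]
        refine apply_eq_zero_of_mem_canonicalGrading (ha (0, i)) r c fun h => hrc (Fin.ext ?_)
        simpa using h.symm
    obtain ⟨d, hd⟩ := hdiag 0
    obtain ⟨d', hd'⟩ := hdiag 1
    rw [LieHom.map_lie, FreeLieAlgebra.lift_of_apply, FreeLieAlgebra.lift_of_apply]
    apply Subtype.ext
    rw [LieSubalgebra.coe_bracket, hd, hd', Ring.lie_def, Matrix.diagonal_mul_diagonal,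
      Matrix.diagonal_mul_diagonal]
    exact sub_eq_zero.2 (congrArg _ (funext fun i => mul_comm _ _))
  · rw [map_word]
    apply Subtype.ext
    ext i j
    -- A word of `N + 1 = n` strictly upper triangular matrices could be nonzero only at `j ≥ i +
    -- n`, which is out of range.
    refine word_apply_eq_zero N _ (fun c r s hrs => ?_) i j (by omega)
    rw [FreeLieAlgebra.lift_of_apply]
    refine apply_eq_zero_of_mem_canonicalGrading (ha _) r s ?_
    have : (z c).val ≠ 0 := (ZMod.val_ne_zero _).2 (hz c)
    dsimp only
    omega

end UpperTriangular

lemma factorial_cast_ne_zero (F : Type*) [Field F] (n : ℕ)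
    (hF : ringChar F = 0 ∨ n ≤ ringChar F) (k : ℕ) (hk : k < n) : (k.factorial : F) ≠ 0 := by
  intro h
  rw [ringChar.spec] at h
  rcases CharP.char_is_prime_or_zero F (ringChar F) with hp | hp
  · have := (hp.dvd_factorial).1 h
    have := hp.pos
    omega
  · rw [hp, zero_dvd_iff] at h
    exact Nat.factorial_ne_zero k h

end GradedSpecht

/-- If `F` is an infinite field whose characteristic is `0` or at least `n`, then every
`T_{ℤ_n}`-ideal of the free `ℤ_n`-graded Lie algebra over `F` that contains the graded identities of
`UT_n(F)^{(-)}` with its canonical grading is finitely generated as a `T_{ℤ_n}`-ideal. -/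
theorem mainTheorem1 (n : ℕ) [NeZero n] (F : Type*) [Field F] [Infinite F]
    (hF : ringChar F = 0 ∨ n ≤ ringChar F) :
    GradedSpecht.HasSpechtProperty (GradedSpecht.canonicalGrading (n := n) F) := by
  have hn : n = (n - 1) + 1 := (Nat.succ_pred_eq_of_ne_zero (NeZero.ne n)).symm
  exact GradedSpecht.hasSpechtProperty_of_basicIdentities _ (n - 1)
    (fun m hm => GradedSpecht.factorial_cast_ne_zero F n hF (m + 1) (by omega))
    (GradedSpecht.basicIdentities_subset_gradedIdentities (n - 1) hn)
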